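/- Let $\mathbb H=(\mathbb R^3,*)$ be the Heisenberg group, $(x,y,z)*(x',y',z')=\big(x+x',\,y+y',\,z+z'+\tfrac12(xy'-yx')\big)$, with left-invariant vector fields $X=\partial_x-\tfrac y2\partial_z$ and $Y=\partial_y+\tfrac x2\partial_z$. For $v\in C^2(\mathbb R^3)$ let $$\nabla^2_{\mathbb H}v(q)=\begin{pmatrix}X^2v(q)&XYv(q)\\ YXv(q)&Y^2v(q)\end{pmatrix},\qquad (\nabla^2_{\mathbb H}v(q))^*=\tfrac12\Big(\nabla^2_{\mathbb H}v(q)+(\nabla^2_{\mathbb H}v(q))^t\Big),$$ and call $v$ horizontally convex if $(\nabla^2_{\mathbb H}v(q))^*\ge 0$ for every $q\in\mathbb H$. Let $B^2_1$ be the Euclidean unit disc in $\mathbb R^2$. **Theorem.** Let $v\in C^2(\mathbb R^3)$ be horizontally convex, and let $\phi:(0,\infty)\to(0,\infty)$ satisfy $\lim_{\varepsilon\to0^+}\phi(\varepsilon)=+\infty$ and $\lim_{\varepsilon\to0^+}\varepsilon\,\phi(\varepsilon)=0$. Then for every $q\in\mathbb H$ $$\inf_{\substack{A\in S^2_+(\mathbb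 R),\ \det A=1\\ A\le\phi(\varepsilon)I}}\ \frac1{\pi}\int_{B^2_1}v\big(q*(\varepsilon A(a,b),0)\big)\,da\,db\;-\;v(q)=\frac{\varepsilon^2}{4}\Big(\det(\nabla^2_{\mathbb H}v(q))^*\Big)^{1/2}+o(\varepsilon^2)\qquad\text{as }\varepsilon\to0^+,$$ where $S^2_+(\mathbb R)$ is the set of symmetric positive semidefinite real $2\times2$ matrices, and $A\le cI$ means that $cI-A$ is positive semidefinite; the quantity inside the infimum is the average of $v(q*(\varepsilon A(a,b),0))$ over $B^2_1$. For all sufficiently small $\varepsilon>0$ the infimum is over a nonempty set of matrices and is finite. -/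

import Mathlib

open Filter Topology Asymptotics MeasureTheory
open scoped Matrix

/-- Points `q = (x, y, z)` of the Heisenberg group; the underlying manifold is `ℝ³`. -/
abbrev Heis : Type := ℝ × ℝ × ℝ

/-- The Heisenberg group law
`(x, y, z) * (x', y', z') = (x + x', y + y', z + z' + (x y' - y x') / 2)`. -/
noncomputable def heisMul (q p : Heis) : Heis :=
  (q.1 + p.1, q.2.1 + p.2.1, q.2.2 + p.2.2 + (1 / 2) * (q.1 * p.2.1 - q.2.1 * p.1))

/-- The left-invariant vector field `X = ∂ₓ - (y/2) ∂_z`, acting on functions. -/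
noncomputable def heisX (v : Heis → ℝ) : Heis → ℝ :=
  fun q => fderiv ℝ v q (1, 0, -q.2.1 / 2)

/-- The left-invariant vector field `Y = ∂_y + (x/2) ∂_z`, acting on functions. -/
noncomputable def heisY (v : Heis → ℝ) : Heis → ℝ :=
  fun q => fderiv ℝ v q (0, 1, q.1 / 2)

/-- The matrix of horizontal second derivatives (not symmetric in general). -/
noncomputable def heisHess (v : Heis → ℝ) (q : Heis) : Matrix (Fin 2) (Fin 2) ℝ :=
  !![heisX (heisX v) q, heisX (heisY v) q;
     heisY (heisX v) q, heisY (heisY v) q]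

/-- The symmetrized horizontal second derivatives. -/
noncomputable def heisSymHess (v : Heis → ℝ) (q : Heis) : Matrix (Fin 2) (Fin 2) ℝ :=
  (1 / 2 : ℝ) • (heisHess v q + (heisHess v q)ᵀ)

/-- Horizontal convexity (for `C²` functions): the symmetrized horizontal second derivatives
are positive semidefinite at every point. -/
def HorizontallyConvex (v : Heis → ℝ) : Prop :=
  ∀ q : Heis, (heisSymHess v q).PosSemidef

/-- The horizontal average `⨍_{B²₁} v(q * (ε A(a,b), 0)) da db`, over the open Euclidean unit
disc; for `A` invertible it is an average over an ellipse in the horizontal plane at `q`. -/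
noncomputable def heisAverage (v : Heis → ℝ) (q : Heis) (ε : ℝ)
    (A : Matrix (Fin 2) (Fin 2) ℝ) : ℝ :=
  ⨍ w in Metric.ball (0 : EuclideanSpace ℝ (Fin 2)) 1,
    v (heisMul q (ε * (A *ᵥ w.ofLp) 0, ε * (A *ᵥ w.ofLp) 1, 0))

/-- Symmetric positive semidefinite `2 × 2` matrices with `det A = 1` and `A ≤ c I`
(in the sense of quadratic forms). -/
def unimodularBelow (c : ℝ) : Set (Matrix (Fin 2) (Fin 2) ℝ) :=
  {A | A.PosSemidef ∧ A.det = 1 ∧ (c • (1 : Matrix (Fin 2) (Fin 2) ℝ) - A).PosSemidef}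

/-- The quadratic form of a symmetric `2 × 2` matrix. -/
def quadForm (S : Matrix (Fin 2) (Fin 2) ℝ) (a b : ℝ) : ℝ :=
  S 0 0 * a ^ 2 + 2 * S 0 1 * (a * b) + S 1 1 * b ^ 2

theorem hasFDerivAt_fderiv_apply {v : Heis → ℝ} (hv : ContDiff ℝ 2 v) {W : Heis → Heis}
    {W' : Heis →L[ℝ] Heis} {p : Heis} (hW : HasFDerivAt W W' p) (d : Heis) :
    fderiv ℝ (fun p => fderiv ℝ v p (W p)) p d =
      fderiv ℝ (fderiv ℝ v) p d (W p) + fderiv ℝ v p (W' d) := by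
  have h1 : DifferentiableAt ℝ (fderiv ℝ v) p :=
    ((hv.fderiv_right (m := 1) (by norm_num)).differentiable (by norm_num)) p
  rw [(h1.hasFDerivAt.clm_apply hW).fderiv]
  simp [add_comm]

theorem hasFDerivAt_fieldX (p : Heis) : HasFDerivAt (fun q : Heis => ((1, 0, -q.2.1 / 2) : Heis))
    ((0 : Heis →L[ℝ] ℝ).prod ((0 : Heis →L[ℝ] ℝ).prod ((-(1 / 2) : ℝ) •
      ((ContinuousLinearMap.fst ℝ ℝ ℝ).comp (ContinuousLinearMap.snd ℝ ℝ (ℝ × ℝ)))))) p := by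
  refine (hasFDerivAt_const _ _).prodMk ((hasFDerivAt_const _ _).prodMk ?_)
  refine (ContinuousLinearMap.hasFDerivAt (_ : Heis →L[ℝ] ℝ)).congr_of_eventuallyEq
    (Eventually.of_forall fun q => ?_)
  simp
  ring

theorem hasFDerivAt_fieldY (p : Heis) : HasFDerivAt (fun q : Heis => ((0, 1, q.1 / 2) : Heis))
    ((0 : Heis →L[ℝ] ℝ).prod ((0 : Heis →L[ℝ] ℝ).prod ((1 / 2 : ℝ) •
      (ContinuousLinearMap.fst ℝ ℝ (ℝ × ℝ))))) p := by
  refine (hasFDerivAt_const _ _).prodMk ((hasFDerivAt_const _ _).prodMk ?_)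
  refine (ContinuousLinearMap.hasFDerivAt (_ : Heis →L[ℝ] ℝ)).congr_of_eventuallyEq
    (Eventually.of_forall fun q => ?_)
  simp
  ring

/-- The first-order terms of `XY` and `YX` cancel in the symmetrization. -/
theorem heisSymHess_eq {v : Heis → ℝ} (hv : ContDiff ℝ 2 v) (p : Heis) :
    heisSymHess v p =
      let X : Heis := (1, 0, -p.2.1 / 2)
      let Y : Heis := (0, 1, p.1 / 2)
      let D := fderiv ℝ (fderiv ℝ v) p
      !![D X X, (D X Y + D Y X) / 2; (D X Y + D Y X) / 2, D Y Y] := by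
  have hz : fderiv ℝ v p (0, 0, -(1 / 2)) = - fderiv ℝ v p (0, 0, 1 / 2) := by
    rw [← map_neg]; simp
  have h0 : fderiv ℝ v p (0, 0, 0) = 0 := map_zero _
  have hXX : heisX (heisX v) p = _ := hasFDerivAt_fderiv_apply hv (hasFDerivAt_fieldX p) _
  have hXY : heisX (heisY v) p = _ := hasFDerivAt_fderiv_apply hv (hasFDerivAt_fieldY p) _
  have hYX : heisY (heisX v) p = _ := hasFDerivAt_fderiv_apply hv (hasFDerivAt_fieldX p) _
  have hYY : heisY (heisY v) p = _ := hasFDerivAt_fderiv_apply hv (hasFDerivAt_fieldY p) _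
  simp only [ContinuousLinearMap.prod_apply, _root_.smul_apply,
    ContinuousLinearMap.comp_apply, ContinuousLinearMap.coe_fst', ContinuousLinearMap.coe_snd',
    _root_.zero_apply, smul_eq_mul, mul_zero, mul_one, h0, hz, add_zero]
    at hXX hXY hYX hYY
  ext i j
  fin_cases i <;> fin_cases j <;> simp [heisSymHess, heisHess, hXX, hXY, hYX, hYY] <;> ring

theorem continuous_heisSymHess_apply {v : Heis → ℝ} (hv : ContDiff ℝ 2 v) (i j : Fin 2) :
    Continuous fun p => heisSymHess v p i j := by
  have hD : Continuous (fderiv ℝ (fderiv ℝ v)) :=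
    (hv.fderiv_right (m := 1) (by norm_num)).continuous_fderiv (by norm_num)
  simp only [heisSymHess_eq hv]
  fin_cases i <;> fin_cases j <;> simp <;> fun_prop

theorem quadForm_heisSymHess {v : Heis → ℝ} (hv : ContDiff ℝ 2 v) (p : Heis) (a b : ℝ) :
    quadForm (heisSymHess v p) a b =
      fderiv ℝ (fderiv ℝ v) p (a, b, (p.1 * b - p.2.1 * a) / 2)
        (a, b, (p.1 * b - p.2.1 * a) / 2) := by
  have hu : ((a, b, (p.1 * b - p.2.1 * a) / 2) : Heis) =
      a • ((1, 0, -p.2.1 / 2) : Heis) + b • ((0, 1, p.1 / 2) : Heis) := by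
    simp; ring
  rw [hu, heisSymHess_eq hv]
  simp only [map_add, map_smul, _root_.add_apply, _root_.smul_apply,
    smul_eq_mul, quadForm]
  simp
  ring

/-- Taylor's formula of order two with Lagrange remainder on `[0, 1]`. -/
theorem exists_taylor_two {h h' h'' : ℝ → ℝ} (h1 : ∀ t, HasDerivAt h (h' t) t)
    (h2 : ∀ t, HasDerivAt h' (h'' t) t) :
    ∃ ξ ∈ Set.Ioo (0 : ℝ) 1, h 1 = h 0 + h' 0 + 1 / 2 * h'' ξ := by
  have hF : ∀ t, HasDerivAt (fun t => h t + h' t * (1 - t)) (h'' t * (1 - t)) t := fun t =>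
    ((h1 t).add ((h2 t).mul ((hasDerivAt_id t).const_sub 1))).congr_deriv (by simp)
  have hG : ∀ t : ℝ, HasDerivAt (fun t => (1 - t) ^ 2) (-2 * (1 - t)) t := fun t =>
    (((hasDerivAt_id t).const_sub 1).pow 2).congr_deriv (by simp)
  obtain ⟨ξ, hξ, h⟩ := exists_ratio_hasDerivAt_eq_ratio_slope _ _ zero_lt_one
    (fun t _ => (hF t).continuousAt.continuousWithinAt) (fun t _ => hF t) _ _
    (fun t _ => (hG t).continuousAt.continuousWithinAt) (fun t _ => hG t)
  refine ⟨ξ, hξ, ?_⟩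
  have hne : (1 - ξ) ≠ 0 := by linarith [hξ.2]
  apply mul_right_cancel₀ hne
  simp at h
  linarith

theorem exists_taylor_horizontal {v : Heis → ℝ} (hv : ContDiff ℝ 2 v) (q : Heis) (a b : ℝ) :
    ∃ ξ ∈ Set.Ioo (0 : ℝ) 1, v (heisMul q (a, b, 0)) =
      v q + fderiv ℝ v q (a, b, (q.1 * b - q.2.1 * a) / 2) +
        1 / 2 * quadForm (heisSymHess v (heisMul q (ξ * a, ξ * b, 0))) a b := by
  set u : Heis := (a, b, (q.1 * b - q.2.1 * a) / 2) with hu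
  have hline : ∀ t : ℝ, HasDerivAt (fun t : ℝ => q + t • u) u t := fun t => by
    simpa using ((hasDerivAt_id t).smul_const u).const_add q
  have hd : Differentiable ℝ v := hv.differentiable (by norm_num)
  have hd' : Differentiable ℝ (fderiv ℝ v) :=
    (hv.fderiv_right (m := 1) (by norm_num)).differentiable (by norm_num)
  have hmul : ∀ t : ℝ, heisMul q (t * a, t * b, 0) = q + t • u := fun t => by
    ext <;> simp [heisMul, hu]
    ring
  obtain ⟨ξ, hξ, h⟩ := exists_taylor_two (h := fun t => v (q + t • u))
    (h' := fun t => fderiv ℝ v (q + t • u) u)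
    (h'' := fun t => fderiv ℝ (fderiv ℝ v) (q + t • u) u u)
    (fun t => (hd _).hasFDerivAt.comp_hasDerivAt t (hline t))
    (fun t => by
      have := ((hd' _).hasFDerivAt.comp_hasDerivAt t (hline t)).clm_apply (hasDerivAt_const t u)
      simpa using this)
  refine ⟨ξ, hξ, ?_⟩
  have h1 := hmul 1
  simp only [one_mul] at h1
  rw [quadForm_heisSymHess hv, hmul ξ, h1]
  have hu' : ((a, b, ((q + ξ • u).1 * b - (q + ξ • u).2.1 * a) / 2) : Heis) = u := by
    simp [hu]; ring
  rw [hu']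
  simpa using h

/-- The quarter turn of the Euclidean plane. -/
noncomputable def quarterTurn :
    EuclideanSpace ℝ (Fin 2) ≃ₗᵢ[ℝ] EuclideanSpace ℝ (Fin 2) where
  toFun w := !₂[-w 1, w 0]
  invFun w := !₂[w 1, -w 0]
  map_add' x y := by ext i; fin_cases i <;> simp; ring
  map_smul' c x := by ext i; fin_cases i <;> simp
  left_inv x := by ext i; fin_cases i <;> simp
  right_inv x := by ext i; fin_cases i <;> simp
  norm_map' x := by simp [EuclideanSpace.norm_eq, Fin.sum_univ_two, add_comm]

theorem Continuous.integrableOn_unitDisc {f : EuclideanSpace ℝ (Fin 2) → ℝ} (hf : Continuous f) :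
    IntegrableOn f (Metric.ball (0 : EuclideanSpace ℝ (Fin 2)) 1) :=
  (hf.continuousOn.integrableOn_compact (isCompact_closedBall _ _)).mono_set
    Metric.ball_subset_closedBall

theorem setIntegral_comp_quarterTurn (f : EuclideanSpace ℝ (Fin 2) → ℝ) :
    ∫ w in Metric.ball (0 : EuclideanSpace ℝ (Fin 2)) 1, f (quarterTurn w) =
      ∫ w in Metric.ball (0 : EuclideanSpace ℝ (Fin 2)) 1, f w := by
  rw [← quarterTurn.measurePreserving.setIntegral_preimage_emb
    quarterTurn.toHomeomorph.measurableEmbedding f]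
  congr 2
  ext w
  simp

theorem volume_real_unitDisc_pos :
    0 < volume.real (Metric.ball (0 : EuclideanSpace ℝ (Fin 2)) 1) :=
  ENNReal.toReal_pos (Metric.measure_ball_pos _ _ one_pos).ne' measure_ball_lt_top.ne

theorem setIntegral_norm_sq_unitDisc :
    ∫ w in Metric.ball (0 : EuclideanSpace ℝ (Fin 2)) 1, ‖w‖ ^ 2 =
      volume.real (Metric.ball (0 : EuclideanSpace ℝ (Fin 2)) 1) / 2 := by
  have h := integral_fun_norm_addHaar (volume : Measure (EuclideanSpace ℝ (Fin 2)))
    ((Set.Iio (1 : ℝ)).indicator fun y => y ^ 2)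
  have h1 : (fun w : EuclideanSpace ℝ (Fin 2) =>
      (Set.Iio (1 : ℝ)).indicator (fun y => y ^ 2) ‖w‖) =
      (Metric.ball (0 : EuclideanSpace ℝ (Fin 2)) 1).indicator fun w => ‖w‖ ^ 2 := by
    ext w
    simp [Set.indicator]
  have h2 : ∫ y in Set.Ioi (0 : ℝ), y ^ (2 - 1) • (Set.Iio (1 : ℝ)).indicator (fun y => y ^ 2) y =
      1 / 4 := by
    have : (fun y : ℝ => y ^ (2 - 1) • (Set.Iio (1 : ℝ)).indicator (fun y => y ^ 2) y) =
        (Set.Iio (1 : ℝ)).indicator fun y => y ^ 3 := by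
      ext y
      by_cases hy : y < 1 <;> simp [Set.indicator, hy]
      ring
    rw [this, setIntegral_indicator measurableSet_Iio, Set.Ioi_inter_Iio, ← integral_Ioc_eq_integral_Ioo,
      ← intervalIntegral.integral_of_le zero_le_one, integral_pow]
    norm_num
  rw [h1, integral_indicator Metric.isOpen_ball.measurableSet, finrank_euclideanSpace_fin, h2] at h
  rw [h]
  simp
  ring

theorem setAverage_quadratic_unitDisc (c l₀ l₁ m₀ m m₁ : ℝ) :
    ⨍ w in Metric.ball (0 : EuclideanSpace ℝ (Fin 2)) 1,
      (c + l₀ * w 0 + l₁ * w 1 + m₀ * w 0 ^ 2 + m * (w 0 * w 1) + m₁ * w 1 ^ 2) =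
      c + (m₀ + m₁) / 4 := by
  set f : EuclideanSpace ℝ (Fin 2) → ℝ := fun w =>
    c + l₀ * w 0 + l₁ * w 1 + m₀ * w 0 ^ 2 + m * (w 0 * w 1) + m₁ * w 1 ^ 2 with hf
  have hfc : Continuous f := by fun_prop
  have e1 := setIntegral_comp_quarterTurn f
  have e2 := setIntegral_comp_quarterTurn fun w => f (quarterTurn w)
  have e3 := setIntegral_comp_quarterTurn fun w => f (quarterTurn (quarterTurn w))
  have key : ∀ w, f w + f (quarterTurn w) + f (quarterTurn (quarterTurn w)) +
      f (quarterTurn (quarterTurn (quarterTurn w))) = 4 * c + 2 * (m₀ + m₁) * ‖w‖ ^ 2 := by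
    intro w
    simp only [hf, quarterTurn, EuclideanSpace.norm_sq_eq, Fin.sum_univ_two, Real.norm_eq_abs,
      sq_abs]
    simp
    ring
  have h4 : ∫ w in Metric.ball (0 : EuclideanSpace ℝ (Fin 2)) 1,
      (4 * c + 2 * (m₀ + m₁) * ‖w‖ ^ 2) =
      4 * ∫ w in Metric.ball (0 : EuclideanSpace ℝ (Fin 2)) 1, f w := by
    simp_rw [← key]
    rw [integral_add, integral_add, integral_add]
    · linarith
    all_goals exact Continuous.integrableOn_unitDisc (by fun_prop)
  rw [integral_add (Continuous.integrableOn_unitDisc (by fun_prop))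
    (Continuous.integrableOn_unitDisc (by fun_prop)), setIntegral_const, integral_const_mul,
    setIntegral_norm_sq_unitDisc, smul_eq_mul] at h4
  rw [setAverage_eq, smul_eq_mul, inv_mul_eq_iff_eq_mul₀ volume_real_unitDisc_pos.ne']
  linarith

theorem setAverage_mono_unitDisc {f g : EuclideanSpace ℝ (Fin 2) → ℝ} (hf : Continuous f)
    (hg : Continuous g) (h : ∀ w ∈ Metric.ball (0 : EuclideanSpace ℝ (Fin 2)) 1, f w ≤ g w) :
    ⨍ w in Metric.ball (0 : EuclideanSpace ℝ (Fin 2)) 1, f w ≤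
      ⨍ w in Metric.ball (0 : EuclideanSpace ℝ (Fin 2)) 1, g w := by
  rw [setAverage_eq, setAverage_eq, smul_eq_mul, smul_eq_mul]
  exact mul_le_mul_of_nonneg_left (setIntegral_mono_on hf.integrableOn_unitDisc
    hg.integrableOn_unitDisc Metric.isOpen_ball.measurableSet h) (by positivity)

theorem Matrix.PosSemidef.quadForm_nonneg {S : Matrix (Fin 2) (Fin 2) ℝ} (hS : S.PosSemidef)
    (a b : ℝ) : 0 ≤ quadForm S a b := by
  have h := hS.dotProduct_mulVec_nonneg ![a, b]
  have hs : S 1 0 = S 0 1 := by simpa using hS.isHermitian.apply 0 1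
  simp [Matrix.mulVec, dotProduct, Fin.sum_univ_two, hs] at h
  unfold quadForm
  linarith

theorem posSemidef_of_quadForm_nonneg {S : Matrix (Fin 2) (Fin 2) ℝ} (hs : S 1 0 = S 0 1)
    (h : ∀ a b, 0 ≤ quadForm S a b) : S.PosSemidef := by
  refine Matrix.PosSemidef.of_dotProduct_mulVec_nonneg ?_ fun x => ?_
  · ext i j
    fin_cases i <;> fin_cases j <;> simp [hs]
  · have := h (x 0) (x 1)
    simp [Matrix.mulVec, dotProduct, Fin.sum_univ_two, hs]
    unfold quadForm at this
    linarith

theorem abs_quadForm_sub_le {S S' : Matrix (Fin 2) (Fin 2) ℝ} {δ : ℝ}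
    (h : ∀ i j, |S i j - S' i j| ≤ δ) (a b : ℝ) :
    |quadForm S a b - quadForm S' a b| ≤ 2 * δ * (a ^ 2 + b ^ 2) := by
  have e : quadForm S a b - quadForm S' a b = (S 0 0 - S' 0 0) * a ^ 2 +
      (S 0 1 - S' 0 1) * (2 * (a * b)) + (S 1 1 - S' 1 1) * b ^ 2 := by
    unfold quadForm; ring
  have hab : |2 * (a * b)| ≤ a ^ 2 + b ^ 2 :=
    abs_le.2 ⟨by nlinarith [sq_nonneg (a + b)], by nlinarith [sq_nonneg (a - b)]⟩
  rw [e]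
  refine (abs_add_three _ _ _).trans ?_
  rw [abs_mul (S 0 0 - _), abs_mul (S 0 1 - _), abs_mul (S 1 1 - _), abs_of_nonneg (sq_nonneg a), abs_of_nonneg (sq_nonneg b)]
  have h0 : 0 ≤ δ := (abs_nonneg _).trans (h 0 0)
  have h1 := mul_le_mul_of_nonneg_right (h 0 0) (sq_nonneg a)
  have h2 := mul_le_mul_of_nonneg_right (h 1 1) (sq_nonneg b)
  have h3 := mul_le_mul (h 0 1) hab (abs_nonneg _) h0
  linarith

/-- The trace of `Aᵀ S A`. -/
def traceConj (A S : Matrix (Fin 2) (Fin 2) ℝ) : ℝ :=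
  quadForm S (A 0 0) (A 1 0) + quadForm S (A 0 1) (A 1 1)

theorem two_mul_sqrt_det_le_traceConj {A S : Matrix (Fin 2) (Fin 2) ℝ} (hS : S.PosSemidef)
    (hA : A.det = 1) : 2 * √S.det ≤ traceConj A S := by
  have h1 := hS.quadForm_nonneg (A 0 0) (A 1 0)
  have h2 := hS.quadForm_nonneg (A 0 1) (A 1 1)
  have hs : S 1 0 = S 0 1 := by simpa using hS.isHermitian.apply 0 1
  have e : quadForm S (A 0 0) (A 1 0) * quadForm S (A 0 1) (A 1 1) = S.det * A.det ^ 2 +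
      (S 0 0 * A 0 0 * A 0 1 + S 0 1 * (A 0 0 * A 1 1 + A 1 0 * A 0 1) +
        S 1 1 * A 1 0 * A 1 1) ^ 2 := by
    simp only [quadForm, Matrix.det_fin_two, hs]; ring
  rw [hA] at e
  unfold traceConj
  rw [← le_div_iff₀' two_pos]
  refine Real.sqrt_le_iff.2 ⟨by linarith, ?_⟩
  nlinarith [sq_nonneg (quadForm S (A 0 0) (A 1 0) - quadForm S (A 0 1) (A 1 1)),
    sq_nonneg (S 0 0 * A 0 0 * A 0 1 + S 0 1 * (A 0 0 * A 1 1 + A 1 0 * A 0 1) +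
        S 1 1 * A 1 0 * A 1 1)]

theorem det_mul_le_trace_mul_quadForm {S : Matrix (Fin 2) (Fin 2) ℝ} (hs : S 1 0 = S 0 1)
    (a b : ℝ) : S.det * (a ^ 2 + b ^ 2) ≤ (S 0 0 + S 1 1) * quadForm S a b := by
  rw [Matrix.det_fin_two, hs]
  unfold quadForm
  linarith [sq_nonneg (S 0 0 * a + S 0 1 * b), sq_nonneg (S 0 1 * a + S 1 1 * b)]

theorem mem_unimodularBelow {A : Matrix (Fin 2) (Fin 2) ℝ} (hA : A.PosSemidef) (hd : A.det = 1)
    {c : ℝ} (hc : A 0 0 + A 1 1 ≤ c) : A ∈ unimodularBelow c := by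
  have hs : A 1 0 = A 0 1 := by simpa using hA.isHermitian.apply 0 1
  refine ⟨hA, hd, posSemidef_of_quadForm_nonneg (by simp [hs]) fun a b => ?_⟩
  have h := hA.quadForm_nonneg b (-a)
  have h' := mul_nonneg (sub_nonneg.2 hc) (add_nonneg (sq_nonneg a) (sq_nonneg b))
  simp [quadForm] at h ⊢
  linarith

theorem abs_le_of_mem_unimodularBelow {A : Matrix (Fin 2) (Fin 2) ℝ} {c : ℝ}
    (hA : A ∈ unimodularBelow c) (i j : Fin 2) : |A i j| ≤ c := by
  obtain ⟨h1, hd, h2⟩ := hA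
  have hs : A 1 0 = A 0 1 := by simpa using h1.isHermitian.apply 0 1
  have a0 := h1.quadForm_nonneg 1 0
  have a1 := h1.quadForm_nonneg 0 1
  have b0 := h2.quadForm_nonneg 1 0
  have b1 := h2.quadForm_nonneg 0 1
  rw [Matrix.det_fin_two, hs] at hd
  simp [quadForm] at a0 a1 b0 b1
  have h01 : |A 0 1| ≤ c := abs_le_of_sq_le_sq (by nlinarith) (by linarith)
  have h00 : |A 0 0| ≤ c := by rwa [abs_of_nonneg a0]
  have h11 : |A 1 1| ≤ c := by rwa [abs_of_nonneg a1]
  fin_cases i <;> fin_cases j <;> simp [h01, h00, h11, hs]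

/-- The minimizer of `A ↦ tr (A P A)` over unimodular symmetric `A`, for `P` positive definite. -/
theorem exists_traceConj_eq {P : Matrix (Fin 2) (Fin 2) ℝ} (hP : P.PosSemidef)
    (hd : 0 < P.det) :
    ∃ A : Matrix (Fin 2) (Fin 2) ℝ, A.PosSemidef ∧ A.det = 1 ∧ traceConj A P = 2 * √P.det := by
  have hs : P 1 0 = P 0 1 := by simpa using hP.isHermitian.apply 0 1
  have p0 := hP.quadForm_nonneg 1 0
  have r0 := hP.quadForm_nonneg 0 1
  simp [quadForm] at p0 r0
  have hσ2 := Real.sq_sqrt hd.le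
  have hσ := Real.sqrt_pos.2 hd
  set σ := √P.det
  rw [Matrix.det_fin_two, hs] at hσ2
  have hn0 : 0 < σ * (P 0 0 + P 1 1 + 2 * σ) := by positivity
  have hn2 := Real.sq_sqrt hn0.le
  have hn := Real.sqrt_pos.2 hn0
  set n := √(σ * (P 0 0 + P 1 1 + 2 * σ))
  refine ⟨!![(P 1 1 + σ) / n, -P 0 1 / n; -P 0 1 / n, (P 0 0 + σ) / n],
    posSemidef_of_quadForm_nonneg (by simp) fun x y => ?_, ?_, ?_⟩
  · have h := hP.quadForm_nonneg y (-x)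
    have e : quadForm !![(P 1 1 + σ) / n, -P 0 1 / n; -P 0 1 / n, (P 0 0 + σ) / n] x y =
        (quadForm P y (-x) + σ * (x ^ 2 + y ^ 2)) / n := by
      simp [quadForm]; ring
    rw [e]
    positivity
  · simp only [Matrix.det_fin_two, Matrix.of_apply, Matrix.cons_val', Matrix.cons_val_zero,
      Matrix.cons_val_one, Matrix.cons_val_fin_one]
    field_simp
    linear_combination -hσ2 - hn2
  · simp only [traceConj, quadForm, Matrix.of_apply, Matrix.cons_val', Matrix.cons_val_zero,
      Matrix.cons_val_one, Matrix.cons_val_fin_one]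
    field_simp
    rw [hn2]
    linear_combination (-P 0 0 - P 1 1 - 4 * σ) * hσ2

theorem exists_traceConj_lt {S : Matrix (Fin 2) (Fin 2) ℝ} (hS : S.PosSemidef) {η : ℝ}
    (hη : 0 < η) :
    ∃ A : Matrix (Fin 2) (Fin 2) ℝ, A.PosSemidef ∧ A.det = 1 ∧
      traceConj A S < 2 * √S.det + η := by
  have hs : S 1 0 = S 0 1 := by simpa using hS.isHermitian.apply 0 1
  have hcont : Continuous fun t : ℝ => 2 * √(S + t • (1 : Matrix (Fin 2) (Fin 2) ℝ)).det := by
    fun_prop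
  have hev : ∀ᶠ t in 𝓝[>] (0 : ℝ),
      2 * √(S + t • (1 : Matrix (Fin 2) (Fin 2) ℝ)).det < 2 * √S.det + η :=
    ((hcont.tendsto 0).mono_left nhdsWithin_le_nhds).eventually_lt_const (by simpa using hη)
  obtain ⟨t, ht, ht0 : 0 < t⟩ := (hev.and self_mem_nhdsWithin).exists
  have e : ∀ a b, quadForm (S + t • (1 : Matrix (Fin 2) (Fin 2) ℝ)) a b =
      quadForm S a b + t * (a ^ 2 + b ^ 2) := fun a b => by
    simp [quadForm]; ring
  have p0 := hS.quadForm_nonneg 1 0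
  have r0 := hS.quadForm_nonneg 0 1
  have d0 : 0 ≤ S.det := hS.det_nonneg
  simp [quadForm] at p0 r0
  have hd : 0 < (S + t • (1 : Matrix (Fin 2) (Fin 2) ℝ)).det := by
    have : (S + t • (1 : Matrix (Fin 2) (Fin 2) ℝ)).det =
        S.det + t * (S 0 0 + S 1 1) + t ^ 2 := by
      simp [Matrix.det_fin_two]; ring
    rw [this]
    positivity
  obtain ⟨A, hA, hA1, hAt⟩ := exists_traceConj_eq
    (posSemidef_of_quadForm_nonneg (by simp [hs]) fun a b => by
      rw [e]; have := hS.quadForm_nonneg a b; positivity) hd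
  refine ⟨A, hA, hA1, lt_of_le_of_lt ?_ ht⟩
  rw [← hAt]
  simp only [traceConj, e]
  have : 0 ≤ t * (A 0 0 ^ 2 + A 1 0 ^ 2) + t * (A 0 1 ^ 2 + A 1 1 ^ 2) := by positivity
  linarith

theorem continuous_heisMul (q : Heis) : Continuous (heisMul q) := by
  unfold heisMul
  fun_prop

theorem setAverage_taylor_model (v : Heis → ℝ) (q : Heis) (ε : ℝ)
    (A K : Matrix (Fin 2) (Fin 2) ℝ) :
    ⨍ w in Metric.ball (0 : EuclideanSpace ℝ (Fin 2)) 1,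
      (v q + fderiv ℝ v q (ε * (A *ᵥ w.ofLp) 0, ε * (A *ᵥ w.ofLp) 1,
        (q.1 * (ε * (A *ᵥ w.ofLp) 1) - q.2.1 * (ε * (A *ᵥ w.ofLp) 0)) / 2) +
        1 / 2 * quadForm K (ε * (A *ᵥ w.ofLp) 0) (ε * (A *ᵥ w.ofLp) 1)) =
      v q + ε ^ 2 / 8 * traceConj A K := by
  have hu : ∀ a b : ℝ, ((a, b, (q.1 * b - q.2.1 * a) / 2) : Heis) =
      a • ((1, 0, -q.2.1 / 2) : Heis) + b • ((0, 1, q.1 / 2) : Heis) := fun a b => by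
    simp; ring
  simp only [hu, map_add, map_smul, smul_eq_mul]
  set X := fderiv ℝ v q (1, 0, -q.2.1 / 2)
  set Y := fderiv ℝ v q (0, 1, q.1 / 2)
  convert setAverage_quadratic_unitDisc (v q) (ε * (A 0 0 * X + A 1 0 * Y))
    (ε * (A 0 1 * X + A 1 1 * Y)) (1 / 2 * ε ^ 2 * quadForm K (A 0 0) (A 1 0))
    (ε ^ 2 * (K 0 0 * A 0 0 * A 0 1 + K 0 1 * (A 0 0 * A 1 1 + A 0 1 * A 1 0) +
      K 1 1 * A 1 0 * A 1 1)) (1 / 2 * ε ^ 2 * quadForm K (A 0 1) (A 1 1)) using 2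
  · ext w
    simp only [Matrix.mulVec, dotProduct, Fin.sum_univ_two, quadForm]
    ring
  · unfold traceConj
    ring

theorem continuous_average_integrand {v : Heis → ℝ} (hv : Continuous v) (q : Heis) (ε : ℝ)
    (A : Matrix (Fin 2) (Fin 2) ℝ) :
    Continuous fun w : EuclideanSpace ℝ (Fin 2) =>
      v (heisMul q (ε * (A *ᵥ w.ofLp) 0, ε * (A *ᵥ w.ofLp) 1, 0)) := by
  refine hv.comp ((continuous_heisMul q).comp ?_)
  simp only [Matrix.mulVec, dotProduct, Fin.sum_univ_two]
  fun_prop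

theorem continuous_taylor_model (v : Heis → ℝ) (q : Heis) (ε : ℝ)
    (A K : Matrix (Fin 2) (Fin 2) ℝ) :
    Continuous fun w : EuclideanSpace ℝ (Fin 2) =>
      (v q + fderiv ℝ v q (ε * (A *ᵥ w.ofLp) 0, ε * (A *ᵥ w.ofLp) 1,
        (q.1 * (ε * (A *ᵥ w.ofLp) 1) - q.2.1 * (ε * (A *ᵥ w.ofLp) 0)) / 2) +
        1 / 2 * quadForm K (ε * (A *ᵥ w.ofLp) 0) (ε * (A *ᵥ w.ofLp) 1)) := by
  simp only [Matrix.mulVec, dotProduct, Fin.sum_univ_two, quadForm]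
  fun_prop

theorem abs_smul_mulVec_le {A : Matrix (Fin 2) (Fin 2) ℝ} {c ε r : ℝ} (hA : ∀ i j, |A i j| ≤ c)
    (hε : 0 ≤ ε) (hr : 2 * (ε * c) ≤ r) {w : EuclideanSpace ℝ (Fin 2)}
    (hw : w ∈ Metric.ball (0 : EuclideanSpace ℝ (Fin 2)) 1) (i : Fin 2) :
    |ε * (A *ᵥ w.ofLp) i| ≤ r := by
  have hw' : ∀ j, |w j| ≤ 1 := fun j =>
    (PiLp.norm_apply_le w j).trans (mem_ball_zero_iff.1 hw).le
  have hc : 0 ≤ c := (abs_nonneg _).trans (hA 0 0)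
  have h : ∀ j, |A i j * w j| ≤ c := fun j => by
    rw [abs_mul]
    exact (mul_le_mul (hA i j) (hw' j) (abs_nonneg _) hc).trans (mul_one c).le
  have h2 : |(A *ᵥ w.ofLp) i| ≤ 2 * c := by
    simp only [Matrix.mulVec, dotProduct, Fin.sum_univ_two]
    exact (abs_add_le _ _).trans (by linarith [h 0, h 1])
  rw [abs_mul, abs_of_nonneg hε]
  exact (mul_le_mul_of_nonneg_left h2 hε).trans (by linarith)

theorem exists_radius_abs_heisSymHess_sub_le {v : Heis → ℝ} (hv : ContDiff ℝ 2 v) (q : Heis)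
    {δ : ℝ} (hδ : 0 < δ) :
    ∃ r > 0, ∀ a b : ℝ, |a| ≤ r → |b| ≤ r → ∀ i j,
      |heisSymHess v (heisMul q (a, b, 0)) i j - heisSymHess v q i j| ≤ δ := by
  have h0 : heisMul q (0, 0, 0) = q := by simp [heisMul]
  have hev : ∀ᶠ x : ℝ × ℝ in 𝓝 (0, 0), ∀ i j,
      |heisSymHess v (heisMul q (x.1, x.2, 0)) i j - heisSymHess v q i j| < δ := by
    simp only [eventually_all]
    intro i j
    have hc : Continuous fun x : ℝ × ℝ => heisSymHess v (heisMul q (x.1, x.2, 0)) i j :=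
      (continuous_heisSymHess_apply hv i j).comp ((continuous_heisMul q).comp (by fun_prop))
    have := Metric.tendsto_nhds.1 (hc.tendsto (0, 0)) δ hδ
    simpa only [h0, Real.dist_eq] using this
  obtain ⟨r, hr, h⟩ := Metric.eventually_nhds_iff.1 hev
  refine ⟨r / 2, by positivity, fun a b ha hb i j => (h (y := (a, b)) ?_ i j).le⟩
  rw [Prod.dist_eq, Real.dist_eq, Real.dist_eq, sub_zero, sub_zero]
  exact max_lt (by linarith) (by linarith)

theorem abs_mul_le_of_mem_Ioo {ξ a r : ℝ} (hξ : ξ ∈ Set.Ioo (0 : ℝ) 1) (ha : |a| ≤ r) :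
    |ξ * a| ≤ r := by
  rw [abs_mul, abs_of_pos hξ.1]
  exact (mul_le_of_le_one_left (abs_nonneg a) hξ.2.le).trans ha

theorem le_heisAverage {v : Heis → ℝ} (hv : ContDiff ℝ 2 v) {q : Heis} {r : ℝ}
    {K : Matrix (Fin 2) (Fin 2) ℝ}
    (hK : ∀ a b : ℝ, |a| ≤ r → |b| ≤ r → ∀ s t,
      quadForm K s t ≤ quadForm (heisSymHess v (heisMul q (a, b, 0))) s t)
    {A : Matrix (Fin 2) (Fin 2) ℝ} {c ε : ℝ} (hA : ∀ i j, |A i j| ≤ c) (hε : 0 ≤ ε)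
    (hr : 2 * (ε * c) ≤ r) :
    v q + ε ^ 2 / 8 * traceConj A K ≤ heisAverage v q ε A := by
  rw [← setAverage_taylor_model]
  refine setAverage_mono_unitDisc (continuous_taylor_model ..)
    (continuous_average_integrand hv.continuous ..) fun w hw => ?_
  obtain ⟨ξ, hξ, h⟩ := exists_taylor_horizontal hv q (ε * (A *ᵥ w.ofLp) 0) (ε * (A *ᵥ w.ofLp) 1)
  rw [h]
  have := hK _ _ (abs_mul_le_of_mem_Ioo hξ (abs_smul_mulVec_le hA hε hr hw 0))
    (abs_mul_le_of_mem_Ioo hξ (abs_smul_mulVec_le hA hε hr hw 1))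
    (ε * (A *ᵥ w.ofLp) 0) (ε * (A *ᵥ w.ofLp) 1)
  linarith

theorem heisAverage_le {v : Heis → ℝ} (hv : ContDiff ℝ 2 v) {q : Heis} {r : ℝ}
    {K : Matrix (Fin 2) (Fin 2) ℝ}
    (hK : ∀ a b : ℝ, |a| ≤ r → |b| ≤ r → ∀ s t,
      quadForm (heisSymHess v (heisMul q (a, b, 0))) s t ≤ quadForm K s t)
    {A : Matrix (Fin 2) (Fin 2) ℝ} {c ε : ℝ} (hA : ∀ i j, |A i j| ≤ c) (hε : 0 ≤ ε)
    (hr : 2 * (ε * c) ≤ r) :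
    heisAverage v q ε A ≤ v q + ε ^ 2 / 8 * traceConj A K := by
  rw [← setAverage_taylor_model]
  refine setAverage_mono_unitDisc (continuous_average_integrand hv.continuous ..)
    (continuous_taylor_model ..) fun w hw => ?_
  obtain ⟨ξ, hξ, h⟩ := exists_taylor_horizontal hv q (ε * (A *ᵥ w.ofLp) 0) (ε * (A *ᵥ w.ofLp) 1)
  rw [h]
  have := hK _ _ (abs_mul_le_of_mem_Ioo hξ (abs_smul_mulVec_le hA hε hr hw 0))
    (abs_mul_le_of_mem_Ioo hξ (abs_smul_mulVec_le hA hε hr hw 1))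
    (ε * (A *ᵥ w.ofLp) 0) (ε * (A *ᵥ w.ofLp) 1)
  linarith

theorem quadForm_smul (k : ℝ) (S : Matrix (Fin 2) (Fin 2) ℝ) (a b : ℝ) :
    quadForm (k • S) a b = k * quadForm S a b := by
  simp [quadForm]; ring

/-- Where the symmetrized Hessian is nondegenerate it dominates any smaller multiple of itself
at nearby points; where it is degenerate convexity alone is used. -/
theorem exists_radius_smul_quadForm_le {v : Heis → ℝ} (hv : ContDiff ℝ 2 v)
    (hconv : HorizontallyConvex v) (q : Heis) {k : ℝ} (hk1 : k < 1)
    (hk : (heisSymHess v q).det = 0 → k = 0) :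
    ∃ r > 0, ∀ a b : ℝ, |a| ≤ r → |b| ≤ r → ∀ s t,
      quadForm (k • heisSymHess v q) s t ≤
        quadForm (heisSymHess v (heisMul q (a, b, 0))) s t := by
  rcases (hconv q).det_nonneg.eq_or_lt with hd | hd
  · refine ⟨1, one_pos, fun a b _ _ s t => ?_⟩
    rw [quadForm_smul, hk hd.symm, zero_mul]
    exact (hconv _).quadForm_nonneg s t
  · set S := heisSymHess v q
    have hs : S 1 0 = S 0 1 := by simpa using (hconv q).isHermitian.apply 0 1
    have p0 := (hconv q).quadForm_nonneg 1 0
    have r0 := (hconv q).quadForm_nonneg 0 1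
    simp only [quadForm, one_pow, mul_one, mul_zero, ne_eq, OfNat.ofNat_ne_zero,
      not_false_eq_true, zero_pow, add_zero, zero_add] at p0 r0
    have htr : 0 < S 0 0 + S 1 1 := by
      rw [Matrix.det_fin_two, hs] at hd
      nlinarith [sq_nonneg (S 0 1)]
    obtain ⟨r, hr, h⟩ := exists_radius_abs_heisSymHess_sub_le hv q
      (δ := (1 - k) * S.det / (2 * (S 0 0 + S 1 1)))
      (div_pos (mul_pos (by linarith) hd) (by linarith))
    refine ⟨r, hr, fun a b ha hb s t => ?_⟩
    have h1 := (abs_le.1 (abs_quadForm_sub_le (h a b ha hb) s t)).1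
    have h2 := det_mul_le_trace_mul_quadForm hs s t
    have h3 : 2 * ((1 - k) * S.det / (2 * (S 0 0 + S 1 1))) * (s ^ 2 + t ^ 2) ≤
        (1 - k) * quadForm S s t := by
      have e : 2 * ((1 - k) * S.det / (2 * (S 0 0 + S 1 1))) * (s ^ 2 + t ^ 2) =
          (1 - k) * (S.det * (s ^ 2 + t ^ 2) / (S 0 0 + S 1 1)) := by
        field_simp
      rw [e]
      exact mul_le_mul_of_nonneg_left ((div_le_iff₀' htr).2 h2) (by linarith)
    rw [quadForm_smul]
    linarith

theorem eventually_le_heisAverage {v : Heis → ℝ} (hv : ContDiff ℝ 2 v)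
    (hconv : HorizontallyConvex v) {φ : ℝ → ℝ}
    (hφ' : Tendsto (fun ε : ℝ => ε * φ ε) (𝓝[>] 0) (𝓝 0)) (q : Heis) {η : ℝ} (hη : 0 < η) :
    ∀ᶠ ε in 𝓝[>] (0 : ℝ), ∀ A ∈ unimodularBelow (φ ε),
      v q + ε ^ 2 / 4 * (√(heisSymHess v q).det - η) ≤ heisAverage v q ε A := by
  set S := heisSymHess v q with hS
  have hd := Real.sqrt_nonneg S.det
  obtain ⟨k, hk0, hk1, hk, hkη⟩ : ∃ k : ℝ, 0 ≤ k ∧ k < 1 ∧ (S.det = 0 → k = 0) ∧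
      √S.det - η ≤ k * √S.det := by
    rcases le_or_gt (√S.det) η with h | h
    · exact ⟨0, le_rfl, one_pos, fun _ => rfl, by linarith⟩
    · have h0 : 0 < √S.det := hη.trans h
      refine ⟨1 - η / √S.det, ?_, ?_, fun h' => ?_, ?_⟩
      · rw [sub_nonneg, div_le_one h0]; exact h.le
      · linarith [div_pos hη h0]
      · simp [h'] at h0
      · rw [sub_mul, div_mul_cancel₀ _ h0.ne', one_mul]
  obtain ⟨r, hr, h⟩ := exists_radius_smul_quadForm_le hv hconv q hk1 hk
  filter_upwards [hφ'.eventually_lt_const (half_pos hr), self_mem_nhdsWithin] with ε h1 hε A hA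
  refine le_trans ?_ (le_heisAverage hv h (abs_le_of_mem_unimodularBelow hA)
    (le_of_lt hε) (by linarith))
  have e : traceConj A (k • S) = k * traceConj A S := by
    simp only [traceConj, quadForm_smul]; ring
  have h2 := mul_le_mul_of_nonneg_left (two_mul_sqrt_det_le_traceConj (hconv q) hA.2.1) hk0
  have h3 := mul_le_mul_of_nonneg_left
    (show 2 * (√S.det - η) ≤ k * traceConj A S by linarith) (by positivity : 0 ≤ ε ^ 2 / 8)
  rw [e]
  linarith

theorem eventually_exists_heisAverage_le {v : Heis → ℝ} (hv : ContDiff ℝ 2 v)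
    (hconv : HorizontallyConvex v) {φ : ℝ → ℝ} (hφ : Tendsto φ (𝓝[>] 0) atTop)
    (q : Heis) {η : ℝ} (hη : 0 < η) :
    ∀ᶠ ε in 𝓝[>] (0 : ℝ), ∃ A ∈ unimodularBelow (φ ε),
      heisAverage v q ε A ≤ v q + ε ^ 2 / 4 * (√(heisSymHess v q).det + η) := by
  set S := heisSymHess v q with hS
  obtain ⟨A, hA, hA1, hAS⟩ := exists_traceConj_lt (hconv q) hη
  set N := A 0 0 ^ 2 + A 1 0 ^ 2 + (A 0 1 ^ 2 + A 1 1 ^ 2)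
  have hN : 0 ≤ N := by positivity
  set δ := η / (2 * (N + 1))
  have hδ : 0 < δ := by positivity
  have hδN : 2 * δ * N ≤ η := by
    have : 2 * δ * (N + 1) = η := by simp only [δ]; field_simp
    linarith
  obtain ⟨r, hr, h⟩ := exists_radius_abs_heisSymHess_sub_le hv q hδ
  set K : Matrix (Fin 2) (Fin 2) ℝ := S + (2 * δ) • (1 : Matrix (Fin 2) (Fin 2) ℝ) with hK
  have eK : ∀ s t, quadForm K s t = quadForm S s t + 2 * δ * (s ^ 2 + t ^ 2) := fun s t => by
    simp [quadForm, hK]; ring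
  set c := A 0 0 + A 1 1
  have hAc := abs_le_of_mem_unimodularBelow (mem_unimodularBelow hA hA1 le_rfl)
  have hlim : Tendsto (fun ε : ℝ => 2 * (ε * c)) (𝓝[>] 0) (𝓝 0) := by
    have : Continuous fun ε : ℝ => 2 * (ε * c) := by fun_prop
    simpa using (this.tendsto 0).mono_left nhdsWithin_le_nhds
  filter_upwards [hφ.eventually_ge_atTop c, hlim.eventually_lt_const hr, self_mem_nhdsWithin]
    with ε h1 h2 hε
  refine ⟨A, mem_unimodularBelow hA hA1 h1, (heisAverage_le hv (K := K) (fun a b ha hb s t => ?_)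
    hAc (le_of_lt hε) h2.le).trans ?_⟩
  · have := (abs_le.1 (abs_quadForm_sub_le (h a b ha hb) s t)).2
    rw [eK]
    linarith
  · have e : traceConj A K = traceConj A S + 2 * δ * N := by
      simp only [traceConj, eK, N]; ring
    have h3 := mul_le_mul_of_nonneg_left
      (show traceConj A K ≤ 2 * (√S.det + η) by linarith) (by positivity : 0 ≤ ε ^ 2 / 8)
    linarith

theorem mainTheorem9 (v : Heis → ℝ) (hv : ContDiff ℝ 2 v) (hconv : HorizontallyConvex v)
    (φ : ℝ → ℝ) (hpos : ∀ ε : ℝ, 0 < ε → 0 < φ ε)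
    (hφ : Tendsto φ (𝓝[>] 0) atTop)
    (hφ' : Tendsto (fun ε : ℝ => ε * φ ε) (𝓝[>] 0) (𝓝 0))
    (q : Heis) :
    (∀ᶠ ε in 𝓝[>] (0 : ℝ), (unimodularBelow (φ ε)).Nonempty ∧
      BddBelow (heisAverage v q ε '' unimodularBelow (φ ε))) ∧
    (fun ε : ℝ => sInf (heisAverage v q ε '' unimodularBelow (φ ε)) - v q
        - ε ^ 2 / 4 * (heisSymHess v q).det ^ (1 / 2 : ℝ))
      =o[𝓝[>] 0] (fun ε : ℝ => ε ^ 2) := by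
  constructor
  · filter_upwards [eventually_le_heisAverage hv hconv hφ' q one_pos,
      eventually_exists_heisAverage_le hv hconv hφ q one_pos] with ε h1 h2
    obtain ⟨A, hA, -⟩ := h2
    exact ⟨⟨A, hA⟩, _, Set.forall_mem_image.2 h1⟩
  · refine isLittleO_iff.2 fun c hc => ?_
    filter_upwards [eventually_le_heisAverage hv hconv hφ' q hc,
      eventually_exists_heisAverage_le hv hconv hφ q hc] with ε h1 h2
    obtain ⟨A, hA, hAle⟩ := h2
    have hlow := le_csInf (Set.Nonempty.image _ ⟨A, hA⟩) (Set.forall_mem_image.2 h1)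
    have hup := (csInf_le ⟨_, Set.forall_mem_image.2 h1⟩ (Set.mem_image_of_mem _ hA)).trans hAle
    rw [← Real.sqrt_eq_rpow, Real.norm_eq_abs, Real.norm_of_nonneg (sq_nonneg ε), abs_le]
    have := mul_nonneg hc.le (sq_nonneg ε)
    constructor <;> linarith
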